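/- Let $X$ be a finite set and $H\le \mathrm{Sym}(X)$. If $X=\bigsqcup_k Y_k$ is a partition into non-empty blocks and $H_k\le\mathrm{Sym}(Y_k)$, where $\mathrm{Sym}(Y_k)$ is regarded as the subgroup of $\mathrm{Sym}(X)$ fixing $X\setminus Y_k$ pointwise, write $H=\prod_k H_k$ if $H$ is the internal direct product of the $H_k$. Among all partitions of $X$ for which $H$ can be written as such a product there is a finest one; $H$ is called connected if $X$ is non-empty and this finest partition is $\{X\}$. If $|Y|=i$, the $S_i$-class of a subgroup of $\mathrm{Sym}(Y)$ is the conjugacy class of subgroups of $S_i$ obtained from any bijection $Y\to\{1,\dots,i\}$. (1) For every $n\ge 0$ there is a bijection from the set of conjugacy classes of subgroups of $S_n$ to the set of pairs $(\lambda,(C_1,\dots,C_n))$, where $\lambda=1^{a_1}2^{a_2}\cdots n^{a_n}$ is a partition of $n$ and, for $1\le i\le n$, $C_i$ is a multiset of $a_i$ conjugacy classes of connected subgroups of $S_i$. It sends the class of $H\le S_n$ to the following pair: let $\{Y_k\}$ be the finest partition of $\{1,\dots,n\}$ with $H=\prod_k H_k$, $H_k\le\mathrm{Sym}(Y_k)$;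 then each $H_k$ is connected, $\lambda$ is the partition of $n$ with parts $|Y_k|$, and $C_i$ is the multiset of $S_i$-classes of those $H_k$ with $|Y_k|=i$. (2) Let $m_n$ be the number of conjugacy classes of subgroups of $S_n$ (OEIS A000638) and $c_k$ the number of conjugacy classes of connected subgroups of $S_k$ (OEIS A005226). Then $(m_n)_{n\ge1}$ is the Euler transform of $(c_k)_{k\ge1}$, that is, as formal power series, $$1+\sum_{n\ge1} m_n x^n=\prod_{k\ge1}\left(\frac{1}{1-x^k}\right)^{c_k}.$$ -/

import Mathlib

open scoped Pointwise

/-- `H ≤ Sym(X)` is the product `∏ K Y` over the blocks `Y` of the partition `P` of `X`, where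
`K Y ≤ Sym(Y)` is regarded as a subgroup of `Sym(X)` fixing all points outside `Y`.
(Subgroups supported on disjoint blocks commute and meet trivially, so the subgroup generated by
the factors is their internal direct product.) -/
def IsBlockProduct {X : Type*} [Fintype X] [DecidableEq X] (H : Subgroup (Equiv.Perm X))
    (P : Finpartition (Finset.univ : Finset X))
    (K : ∀ Y : P.parts, Subgroup (Equiv.Perm Y.1)) : Prop :=
  H = ⨆ Y : P.parts, (K Y).map (Equiv.Perm.ofSubtype (p := fun x => x ∈ Y.1))

/-- `P` is the finest partition of `X` along which `H` is a product. In `Finpartition`,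
`P ≤ Q` means that `P` refines `Q`. -/
def IsFinestPartition {X : Type*} [Fintype X] [DecidableEq X] (H : Subgroup (Equiv.Perm X))
    (P : Finpartition (Finset.univ : Finset X)) : Prop :=
  IsLeast {Q | ∃ K, IsBlockProduct H Q K} P

/-- `H ≤ Sym(X)` is connected if its finest partition has `X` as its only block. -/
def IsConnectedSubgroup {X : Type*} [Fintype X] [DecidableEq X]
    (H : Subgroup (Equiv.Perm X)) : Prop :=
  ∃ P, IsFinestPartition H P ∧ P.parts = {Finset.univ}

/-- Conjugacy classes of subgroups of `S_n`: orbits of `S_n` acting on its subgroups by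
conjugation. -/
abbrev SubgroupConjClass (n : ℕ) : Type :=
  MulAction.orbitRel.Quotient (ConjAct (Equiv.Perm (Fin n))) (Subgroup (Equiv.Perm (Fin n)))

/-- The conjugacy class of a subgroup of `S_n`. -/
def subgroupConjClass {n : ℕ} (H : Subgroup (Equiv.Perm (Fin n))) : SubgroupConjClass n :=
  Quotient.mk _ H

/-- Conjugacy classes of connected subgroups of `S_n`. -/
abbrev ConnectedClass (n : ℕ) : Type :=
  {c : SubgroupConjClass n // ∃ H, IsConnectedSubgroup H ∧ subgroupConjClass H = c}

/-- The `S_i`-class of a subgroup of `Sym(Y)` where `|Y| = i`, obtained by numbering the elements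
of `Y`; the numbering is irrelevant by `classOn_eq`. -/
noncomputable def classOn {Y : Type*} [Fintype Y] {i : ℕ} (h : Fintype.card Y = i)
    (K : Subgroup (Equiv.Perm Y)) : SubgroupConjClass i :=
  subgroupConjClass (K.map (Fintype.equivFinOfCardEq h).permCongrHom.toMonoidHom)

theorem classOn_eq {Y : Type*} [Fintype Y] {i : ℕ} (h : Fintype.card Y = i)
    (K : Subgroup (Equiv.Perm Y)) (e : Y ≃ Fin i) :
    classOn h K = subgroupConjClass (K.map e.permCongrHom.toMonoidHom) := by
  refine Quotient.sound ?_
  refine ⟨ConjAct.toConjAct (e.symm.trans (Fintype.equivFinOfCardEq h)), ?_⟩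
  ext σ
  simp only [Subgroup.mem_smul_pointwise_iff_exists, Subgroup.mem_map]
  constructor
  · rintro ⟨_, ⟨τ, hτ, rfl⟩, rfl⟩
    refine ⟨τ, hτ, ?_⟩
    ext x
    simp [ConjAct.toConjAct_smul, Equiv.permCongrHom, Equiv.Perm.inv_def]
  · rintro ⟨τ, hτ, rfl⟩
    refine ⟨_, ⟨τ, hτ, rfl⟩, ?_⟩
    ext x
    simp [ConjAct.toConjAct_smul, Equiv.permCongrHom, Equiv.Perm.inv_def]

/-- Pairs `(λ, (C_1, …, C_n))` where `λ = 1^{a_1} … n^{a_n}` is a partition of `n` and `C_i` is a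
multiset of `a_i` conjugacy classes of connected subgroups of `S_i`. -/
structure PartitionPair (n : ℕ) : Type where
  shape : n.Partition
  classes : ∀ i : Finset.Icc 1 n, Sym (ConnectedClass i) (shape.parts.count (i : ℕ))

/-- The multiset of `S_i`-classes of the factors `K Y` with `|Y| = i`. -/
noncomputable def factorClasses {X : Type*} [Fintype X] [DecidableEq X]
    (P : Finpartition (Finset.univ : Finset X))
    (K : ∀ Y : P.parts, Subgroup (Equiv.Perm Y.1)) (i : ℕ) : Multiset (SubgroupConjClass i) :=
  (Finset.univ : Finset {Y : P.parts // Fintype.card Y.1 = i}).val.map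
    fun Y => classOn Y.2 (K Y.1)

open scoped PowerSeries.WithPiTopology in
/-- `(m_1, m_2, …)` is the Euler transform of `(c_1, c_2, …)`:
`1 + ∑_{n ≥ 1} m_n x^n = ∏_{k ≥ 1} (1 / (1 - x^k))^{c_k}` as formal power series over `ℤ`, the
infinite product converging coefficientwise. The values `m 0` and `c 0` play no role. -/
def IsEulerTransform (m c : ℕ → ℕ) : Prop :=
  HasProd (fun k : ℕ+ =>
      (PowerSeries.invOfUnit (1 - PowerSeries.X ^ (k : ℕ) : PowerSeries ℤ) 1) ^ c k)
    (1 + PowerSeries.mk fun n => if n = 0 then 0 else (m n : ℤ))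

/-!
Say that `H` splits along `S` if it contains, for each `h ∈ H`, the permutation that agrees with
`h` on `S` and fixes every point outside `S`. The sets along which `H` splits form a Boolean
algebra; the blocks of any product decomposition of `H` belong to it, and its atoms are the blocks
of the finest one. A set along which `H` splits is an atom exactly if the group induced on it is
connected, so every decomposition of `H` into connected factors is the finest one. Hence the
multiset of isomorphism types of the connected factors determines `H` up to conjugacy, and every
multiset of connected types of total degree `n` arises from a product acting on a disjoint union.
Sorting such a multiset by degree gives the pair `(λ, (C_1, …, C_n))`. The number of multisets of
`a` classes of degree `k` is the coefficient of `x ^ (k * a)` in `(1 - x ^ k) ^ (-c_k)`, so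
expanding the product over `k` gives the Euler transform.
-/

namespace PermGroup

section Truncation

variable {X : Type*}

/-- `g` is the truncation of `h` to `S`: it agrees with `h` on `S` and fixes all other points. -/
structure IsTruncation (S : Set X) (h g : Equiv.Perm X) : Prop where
  eq_on : ∀ x ∈ S, g x = h x
  fix_compl : ∀ x ∉ S, g x = x

namespace IsTruncation

variable {S T : Set X} {g h k l : Equiv.Perm X}

theorem apply_mem_iff_right (hg : IsTruncation S h g) (x : X) : g x ∈ S ↔ x ∈ S := by
  refine ⟨fun hgx => ?_, fun hx => ?_⟩
  · by_contra hx
    exact hx (hg.fix_compl x hx ▸ hgx)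
  · by_contra hgx
    exact hgx ((g.injective (hg.fix_compl _ hgx)).symm ▸ hx)

theorem apply_mem_iff_left (hg : IsTruncation S h g) (x : X) : h x ∈ S ↔ x ∈ S := by
  refine ⟨fun hhx => ?_, fun hx => hg.eq_on x hx ▸ (hg.apply_mem_iff_right x).2 hx⟩
  obtain ⟨y, hy⟩ := g.surjective (h x)
  have hyS : y ∈ S := (hg.apply_mem_iff_right y).1 (hy ▸ hhx)
  have hyx : y = x := h.injective ((hg.eq_on y hyS).symm.trans hy)
  exact hyx ▸ hyS

theorem one_of_fix (hh : ∀ x ∈ S, h x = x) : IsTruncation S h 1 :=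
  ⟨fun x hx => (hh x hx).symm, fun _ _ => rfl⟩

theorem inter (hg : IsTruncation S h g) (hk : IsTruncation T g k) : IsTruncation (S ∩ T) h k where
  eq_on x hx := (hk.eq_on x hx.2).trans (hg.eq_on x hx.1)
  fix_compl x hx := by
    by_cases hxT : x ∈ T
    · rw [hk.eq_on x hxT, hg.fix_compl x fun hxS => hx ⟨hxS, hxT⟩]
    · exact hk.fix_compl x hxT

theorem compl (hg : IsTruncation S h g) : IsTruncation Sᶜ h (g⁻¹ * h) where
  eq_on x hx := by
    rw [Equiv.Perm.mul_apply, Equiv.Perm.inv_eq_iff_eq,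
      hg.fix_compl _ (mt (hg.apply_mem_iff_left x).1 hx)]
  fix_compl x hx := by
    rw [Equiv.Perm.mul_apply, Equiv.Perm.inv_eq_iff_eq, hg.eq_on x (not_not.1 hx)]

theorem mul (hg : IsTruncation S h g) (hk : IsTruncation S l k) :
    IsTruncation S (h * l) (g * k) where
  eq_on x hx := by
    rw [Equiv.Perm.mul_apply, Equiv.Perm.mul_apply, hk.eq_on x hx,
      hg.eq_on _ ((hk.apply_mem_iff_left x).2 hx)]
  fix_compl x hx := by rw [Equiv.Perm.mul_apply, hk.fix_compl x hx, hg.fix_compl x hx]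

theorem union (hST : Disjoint S T) (hg : IsTruncation S h g) (hk : IsTruncation T h k) :
    IsTruncation (S ∪ T) h (g * k) where
  eq_on x hx := by
    rw [Equiv.Perm.mul_apply]
    rcases hx with hxS | hxT
    · rw [hk.fix_compl x (hST.notMem_of_mem_left hxS), hg.eq_on x hxS]
    · rw [hk.eq_on x hxT,
        hg.fix_compl _ (hST.notMem_of_mem_right ((hk.apply_mem_iff_left x).2 hxT))]
  fix_compl x hx := by
    rw [Set.mem_union, not_or] at hx
    rw [Equiv.Perm.mul_apply, hk.fix_compl x hx.2, hg.fix_compl x hx.1]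

end IsTruncation

theorem exists_isTruncation_biUnion {ι : Type*} {M : Subgroup (Equiv.Perm X)} {h : Equiv.Perm X}
    {S : ι → Set X} {s : Finset ι} (hdisj : (s : Set ι).PairwiseDisjoint S)
    (hS : ∀ i ∈ s, ∃ g ∈ M, IsTruncation (S i) h g) :
    ∃ g ∈ M, IsTruncation (⋃ i ∈ s, S i) h g := by
  classical
  induction s using Finset.induction_on with
  | empty => exact ⟨1, M.one_mem, .one_of_fix (by simp)⟩
  | insert i s hi ih =>
    rw [Finset.coe_insert, Set.pairwiseDisjoint_insert_of_notMem (by simpa using hi)] at hdisj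
    obtain ⟨g, hgM, hg⟩ := hS i (Finset.mem_insert_self i s)
    obtain ⟨k, hkM, hk⟩ := ih hdisj.1 fun j hj => hS j (Finset.mem_insert_of_mem hj)
    rw [Finset.set_biUnion_insert]
    exact ⟨g * k, M.mul_mem hgM hkM, hg.union (Set.disjoint_iUnion₂_right.2 hdisj.2) hk⟩

end Truncation

section Splits

variable {X : Type*} {H : Subgroup (Equiv.Perm X)} {S T : Set X}

/-- `H` splits along `S` if it contains the truncation to `S` of each of its elements, that is,
if it is the internal direct product of a subgroup supported on `S` and one supported on `Sᶜ`. -/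
def Splits (H : Subgroup (Equiv.Perm X)) (S : Set X) : Prop :=
  ∀ h ∈ H, ∃ g ∈ H, IsTruncation S h g

theorem splits_univ (H : Subgroup (Equiv.Perm X)) : Splits H Set.univ :=
  fun h hh => ⟨h, hh, fun _ _ => rfl, fun x hx => (hx (Set.mem_univ x)).elim⟩

theorem Splits.compl (hS : Splits H S) : Splits H Sᶜ := fun h hh =>
  let ⟨_, hgH, hg⟩ := hS h hh
  ⟨_, H.mul_mem (H.inv_mem hgH) hh, hg.compl⟩

theorem Splits.inter (hS : Splits H S) (hT : Splits H T) : Splits H (S ∩ T) := fun h hh =>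
  let ⟨g, hgH, hg⟩ := hS h hh
  let ⟨k, hkH, hk⟩ := hT g hgH
  ⟨k, hkH, hg.inter hk⟩

theorem Splits.diff (hS : Splits H S) (hT : Splits H T) : Splits H (S \ T) :=
  hS.inter hT.compl

/-- The atoms of the Boolean algebra of sets along which `H` splits. For finite `X` they turn out
to be the blocks of the finest partition. -/
def IsSplitAtom (H : Subgroup (Equiv.Perm X)) : Set X → Prop :=
  Minimal fun S => S.Nonempty ∧ Splits H S

theorem IsSplitAtom.nonempty (hS : IsSplitAtom H S) : S.Nonempty := hS.prop.1

theorem IsSplitAtom.splits (hS : IsSplitAtom H S) : Splits H S := hS.prop.2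

theorem IsSplitAtom.subset_of_mem {x : X} (hS : IsSplitAtom H S) (hT : Splits H T)
    (hxS : x ∈ S) (hxT : x ∈ T) : S ⊆ T :=
  have hST : (S ∩ T).Nonempty ∧ Splits H (S ∩ T) := ⟨⟨x, hxS, hxT⟩, hS.splits.inter hT⟩
  (hS.le_of_le hST Set.inter_subset_left).trans Set.inter_subset_right

theorem IsSplitAtom.eq_of_mem {x : X} (hS : IsSplitAtom H S) (hT : IsSplitAtom H T)
    (hxS : x ∈ S) (hxT : x ∈ T) : S = T :=
  (hS.subset_of_mem hT.splits hxS hxT).antisymm (hT.subset_of_mem hS.splits hxT hxS)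

theorem exists_isSplitAtom_mem [Finite X] (H : Subgroup (Equiv.Perm X)) (x : X) :
    ∃ S, IsSplitAtom H S ∧ x ∈ S := by
  obtain ⟨S, -, ⟨hxS, hS⟩, hmin⟩ := exists_minimal_le_of_wellFoundedLT
    (fun S : Set X => x ∈ S ∧ Splits H S) Set.univ ⟨Set.mem_univ x, splits_univ H⟩
  refine ⟨S, ⟨⟨⟨x, hxS⟩, hS⟩, ?_⟩, hxS⟩
  rintro T ⟨⟨y, hyT⟩, hT⟩ hTS
  by_cases hxT : x ∈ T
  · exact hmin ⟨hxT, hT⟩ hTS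
  · have hST : x ∈ S \ T ∧ Splits H (S \ T) := ⟨⟨hxS, hxT⟩, hS.diff hT⟩
    exact ((hmin hST Set.sdiff_subset (hTS hyT)).2 hyT).elim

end Splits

section Restrict

variable {X : Type*} [DecidableEq X] {H : Subgroup (Equiv.Perm X)} {Y : Finset X}

/-- The subgroup of `Sym(Y)` of all permutations whose extension by the identity is in `H`. -/
def restrict (H : Subgroup (Equiv.Perm X)) (Y : Finset X) : Subgroup (Equiv.Perm Y) :=
  H.comap (Equiv.Perm.ofSubtype (p := fun x => x ∈ Y))

theorem isTruncation_ofSubtype_iff {h : Equiv.Perm X} {τ : Equiv.Perm Y} :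
    IsTruncation Y h (Equiv.Perm.ofSubtype (p := fun x => x ∈ Y) τ) ↔ ∀ y : Y, h y = τ y := by
  refine ⟨fun hτ y => ?_, fun hτ => ⟨fun x hx => ?_, fun x hx => ?_⟩⟩
  · rw [← hτ.eq_on y y.2, Equiv.Perm.ofSubtype_apply_coe]
  · rw [hτ ⟨x, hx⟩, Equiv.Perm.ofSubtype_apply_of_mem τ hx]
  · exact Equiv.Perm.ofSubtype_apply_of_not_mem τ hx

theorem exists_ofSubtype_eq {g : Equiv.Perm X} (hg : ∀ x ∉ Y, g x = x) :
    ∃ τ : Equiv.Perm Y, Equiv.Perm.ofSubtype (p := fun x => x ∈ Y) τ = g := by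
  have hgY : IsTruncation (Y : Set X) g g := ⟨fun _ _ => rfl, hg⟩
  exact ⟨g.subtypePerm hgY.apply_mem_iff_right,
    Equiv.Perm.ofSubtype_subtypePerm _ fun x hx => not_not.1 (mt (hg x) hx)⟩

theorem exists_isTruncation_iff_exists_mem_restrict {h : Equiv.Perm X} :
    (∃ g ∈ H, IsTruncation Y h g) ↔ ∃ τ ∈ restrict H Y, ∀ y : Y, h y = τ y := by
  constructor
  · rintro ⟨g, hgH, hg⟩
    obtain ⟨τ, rfl⟩ := exists_ofSubtype_eq hg.fix_compl
    exact ⟨τ, hgH, isTruncation_ofSubtype_iff.1 hg⟩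
  · rintro ⟨τ, hτH, hτ⟩
    exact ⟨_, hτH, isTruncation_ofSubtype_iff.2 hτ⟩

theorem Splits.mem_restrict_iff (hY : Splits H Y) {τ : Equiv.Perm Y} :
    τ ∈ restrict H Y ↔ ∃ h ∈ H, ∀ y : Y, h y = τ y := by
  refine ⟨fun hτ => ⟨_, hτ, fun y => Equiv.Perm.ofSubtype_apply_coe τ y⟩, ?_⟩
  rintro ⟨h, hhH, hh⟩
  obtain ⟨σ, hσH, hσ⟩ := exists_isTruncation_iff_exists_mem_restrict.1 (hY h hhH)
  obtain rfl : σ = τ := Equiv.ext fun y => Subtype.ext ((hσ y).symm.trans (hh y))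
  exact hσH

theorem isTruncation_image_val_iff {S : Set Y} {τ σ : Equiv.Perm Y} :
    IsTruncation (Subtype.val '' S) (Equiv.Perm.ofSubtype (p := fun x => x ∈ Y) τ)
      (Equiv.Perm.ofSubtype (p := fun x => x ∈ Y) σ) ↔ IsTruncation S τ σ := by
  refine ⟨fun h => ⟨fun y hy => ?_, fun y hy => ?_⟩, fun h => ⟨?_, fun x hx => ?_⟩⟩
  · have hy' := h.eq_on y (Set.mem_image_of_mem _ hy)
    rwa [Equiv.Perm.ofSubtype_apply_coe, Equiv.Perm.ofSubtype_apply_coe, Subtype.coe_inj] at hy'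
  · have hy' := h.fix_compl y (mt (Function.Injective.mem_set_image Subtype.val_injective).1 hy)
    rwa [Equiv.Perm.ofSubtype_apply_coe, Subtype.coe_inj] at hy'
  · rintro _ ⟨y, hy, rfl⟩
    simp [h.eq_on y hy]
  · by_cases hxY : x ∈ Y
    · rw [Equiv.Perm.ofSubtype_apply_of_mem _ hxY,
        h.fix_compl _ fun hxS => hx (Set.mem_image_of_mem _ hxS)]
    · exact Equiv.Perm.ofSubtype_apply_of_not_mem _ hxY

theorem Splits.restrict_iff (hY : Splits H Y) {S : Set Y} :
    Splits (restrict H Y) S ↔ Splits H (Subtype.val '' S) := by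
  have hSY : Subtype.val '' S ⊆ (Y : Set X) := by
    rintro _ ⟨y, -, rfl⟩
    exact y.2
  constructor
  · intro hS h hhH
    obtain ⟨g, hgH, hg⟩ := hY h hhH
    obtain ⟨τ, rfl⟩ := exists_ofSubtype_eq hg.fix_compl
    obtain ⟨σ, hσH, hσ⟩ := hS τ hgH
    refine ⟨_, hσH, ?_⟩
    rw [← Set.inter_eq_right.2 hSY]
    exact hg.inter (isTruncation_image_val_iff.2 hσ)
  · intro hS τ hτ
    obtain ⟨g, hgH, hg⟩ := hS _ hτ
    obtain ⟨σ, rfl⟩ := exists_ofSubtype_eq fun x hx => hg.fix_compl x fun hxS => hx (hSY hxS)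
    exact ⟨σ, hgH, isTruncation_image_val_iff.1 hg⟩

theorem Splits.isSplitAtom_univ_restrict_iff (hY : Splits H Y) :
    IsSplitAtom (restrict H Y) Set.univ ↔ IsSplitAtom H Y := by
  have huniv : Subtype.val '' (Set.univ : Set Y) = Y := by simp
  constructor
  · intro h
    refine ⟨⟨huniv ▸ h.nonempty.image _, hY⟩, fun T hT hTY => ?_⟩
    obtain ⟨S, rfl⟩ : ∃ S : Set Y, Subtype.val '' S = T :=
      ⟨_, Subtype.image_preimage_val _ _ |>.trans (Set.inter_eq_right.2 hTY)⟩
    have hS : Set.univ ≤ S :=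
      h.le_of_le ⟨Set.image_nonempty.1 hT.1, hY.restrict_iff.2 hT.2⟩ (Set.subset_univ S)
    exact huniv ▸ Set.image_mono hS
  · intro h
    refine ⟨⟨Set.image_nonempty.1 (huniv ▸ h.nonempty), splits_univ _⟩, fun S hS _ y _ => ?_⟩
    obtain ⟨x, hxS⟩ := hS.1
    obtain ⟨z, hzS, hzy⟩ := h.subset_of_mem (hY.restrict_iff.1 hS.2) x.2
      (Set.mem_image_of_mem _ hxS) y.2
    exact Subtype.ext hzy ▸ hzS

end Restrict

section Finest

variable {X : Type*} [Fintype X] [DecidableEq X] {H : Subgroup (Equiv.Perm X)}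
  {P : Finpartition (Finset.univ : Finset X)} {Y : Finset X}

theorem mem_of_forall_exists_isTruncation {M : Subgroup (Equiv.Perm X)} {h : Equiv.Perm X}
    (hP : ∀ Y ∈ P.parts, ∃ g ∈ M, IsTruncation Y h g) : h ∈ M := by
  obtain ⟨g, hgM, hg⟩ := exists_isTruncation_biUnion (S := fun Y : Finset X => (Y : Set X))
    (fun A hA B hB hAB => Finset.disjoint_coe.2 (P.disjoint hA hB hAB)) hP
  obtain rfl : g = h := Equiv.ext fun x =>
    hg.eq_on x (by simpa using P.exists_mem (Finset.mem_univ x))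
  exact hgM

theorem isBlockProduct_restrict (hP : ∀ Y ∈ P.parts, Splits H Y) :
    IsBlockProduct H P fun Y => restrict H Y.1 := by
  have hle (Y : P.parts) :
      (restrict H Y.1).map (Equiv.Perm.ofSubtype (p := fun x => x ∈ Y.1)) ≤ H :=
    Subgroup.map_comap_le _ H
  refine le_antisymm (fun h hh => ?_) (iSup_le hle)
  refine mem_of_forall_exists_isTruncation (P := P) fun Y hY => ?_
  obtain ⟨τ, hτ, hhτ⟩ := exists_isTruncation_iff_exists_mem_restrict.1 (hP Y hY h hh)
  exact ⟨Equiv.Perm.ofSubtype (p := fun x => x ∈ Y) τ,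
    Subgroup.mem_iSup_of_mem (⟨Y, hY⟩ : P.parts) (Subgroup.mem_map_of_mem _ hτ),
    isTruncation_ofSubtype_iff.2 hhτ⟩

theorem splits_of_isBlockProduct {K : ∀ Y : P.parts, Subgroup (Equiv.Perm Y.1)}
    (hK : IsBlockProduct H P K) (hY : Y ∈ P.parts) : Splits H Y := by
  have hle (Z : P.parts) : (K Z).map (Equiv.Perm.ofSubtype (p := fun x => x ∈ Z.1)) ≤ H :=
    (le_iSup _ Z).trans_eq hK.symm
  intro h hh
  rw [hK] at hh
  induction hh using Subgroup.iSup_induction' with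
  | h1 => exact ⟨1, H.one_mem, .one_of_fix fun _ _ => rfl⟩
  | hp Z σ hσ =>
    have hσH := hle Z hσ
    obtain ⟨τ, -, rfl⟩ := hσ
    by_cases hZY : Z.1 = Y
    · subst hZY
      exact ⟨_, hσH, isTruncation_ofSubtype_iff.2 fun y => Equiv.Perm.ofSubtype_apply_coe τ y⟩
    · refine ⟨1, H.one_mem, .one_of_fix fun x hxY => Equiv.Perm.ofSubtype_apply_of_not_mem τ ?_⟩
      exact fun hxZ => hZY (P.eq_of_mem_parts Z.2 hY hxZ hxY)
  | hmul a b _ _ iha ihb =>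
    obtain ⟨g, hgH, hg⟩ := iha
    obtain ⟨k, hkH, hk⟩ := ihb
    exact ⟨g * k, H.mul_mem hgH hkH, hg.mul hk⟩

open Classical in
/-- The partition of `X` into the split atoms of `H`. It is the finest partition along which `H`
is a product. -/
noncomputable def finest (H : Subgroup (Equiv.Perm X)) : Finpartition (Finset.univ : Finset X) :=
  .ofExistsUnique ({Y : Finset X | IsSplitAtom H (Y : Set X)} : Finset (Finset X))
    (fun Y _ => Y.subset_univ)
    (fun x _ => by
      obtain ⟨S, hS, hxS⟩ := exists_isSplitAtom_mem H x
      refine ⟨S.toFinset, by simp [hS, hxS], fun Y ⟨hY, hxY⟩ => ?_⟩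
      exact Finset.coe_injective ((Finset.mem_filter.1 hY).2.eq_of_mem (by simpa using hS) hxY
        (by simpa using hxS)))
    (fun h => by simpa using (Finset.mem_filter.1 h).2.nonempty)

theorem mem_finest_parts_iff : Y ∈ (finest H).parts ↔ IsSplitAtom H Y := by
  classical
  exact Finset.mem_filter.trans (and_iff_right (Finset.mem_univ Y))

theorem isBlockProduct_finest (H : Subgroup (Equiv.Perm X)) :
    IsBlockProduct H (finest H) fun Y => restrict H Y.1 :=
  isBlockProduct_restrict fun _ hY => (mem_finest_parts_iff.1 hY).splits

theorem isFinestPartition_finest (H : Subgroup (Equiv.Perm X)) :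
    IsFinestPartition H (finest H) := by
  refine ⟨⟨_, isBlockProduct_finest H⟩, ?_⟩
  rintro Q ⟨K, hK⟩ Y hY
  have hY' := mem_finest_parts_iff.1 hY
  obtain ⟨x, hxY⟩ := hY'.nonempty
  obtain ⟨Z, hZ, hxZ⟩ := Q.exists_mem (Finset.mem_univ x)
  exact ⟨Z, hZ, hY'.subset_of_mem (splits_of_isBlockProduct hK hZ) hxY hxZ⟩

theorem isConnectedSubgroup_iff : IsConnectedSubgroup H ↔ IsSplitAtom H Set.univ := by
  rw [← Finset.coe_univ, ← mem_finest_parts_iff]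
  constructor
  · rintro ⟨P, hP, hparts⟩
    rw [(isFinestPartition_finest H).unique hP, hparts]
    exact Finset.mem_singleton_self _
  · intro h
    refine ⟨_, isFinestPartition_finest H, Finset.eq_singleton_iff_unique_mem.2 ⟨h, ?_⟩⟩
    intro Y hY
    obtain ⟨x, hxY⟩ := (finest H).nonempty_of_mem_parts hY
    exact (finest H).eq_of_mem_parts hY h hxY (Finset.mem_univ x)

theorem mem_finest_parts_iff_isConnectedSubgroup (hY : Splits H Y) :
    Y ∈ (finest H).parts ↔ IsConnectedSubgroup (restrict H Y) := by
  rw [mem_finest_parts_iff, isConnectedSubgroup_iff, hY.isSplitAtom_univ_restrict_iff]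

theorem isConnectedSubgroup_restrict (hY : Y ∈ (finest H).parts) :
    IsConnectedSubgroup (restrict H Y) :=
  (mem_finest_parts_iff_isConnectedSubgroup (mem_finest_parts_iff.1 hY).splits).1 hY

end Finest

section PermIso

variable {X Y Z : Type*} {H : Subgroup (Equiv.Perm X)} {K : Subgroup (Equiv.Perm Y)}
  {L : Subgroup (Equiv.Perm Z)}

/-- The bijection `e` carries the permutation group `H` on `X` to the permutation group `K`
on `Y`. -/
def CarriesTo (e : X ≃ Y) (H : Subgroup (Equiv.Perm X)) (K : Subgroup (Equiv.Perm Y)) : Prop :=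
  ∀ h, e.permCongr h ∈ K ↔ h ∈ H

/-- Isomorphism of permutation groups, which for subgroups of `S_n` is conjugacy. -/
def PermIso (H : Subgroup (Equiv.Perm X)) (K : Subgroup (Equiv.Perm Y)) : Prop :=
  ∃ e : X ≃ Y, CarriesTo e H K

theorem CarriesTo.symm {e : X ≃ Y} (he : CarriesTo e H K) : CarriesTo e.symm K H := fun k => by
  rw [← he, ← Equiv.permCongr_symm, Equiv.apply_symm_apply]

theorem carriesTo_map (e : X ≃ Y) (H : Subgroup (Equiv.Perm X)) :
    CarriesTo e H (H.map e.permCongrHom.toMonoidHom) :=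
  fun h => Subgroup.mem_map_equiv.trans (by
    rw [show e.permCongrHom.symm (e.permCongr h) = h from e.permCongr.symm_apply_apply h])

namespace PermIso

theorem refl (H : Subgroup (Equiv.Perm X)) : PermIso H H := ⟨Equiv.refl X, fun _ => Iff.rfl⟩

theorem symm : PermIso H K → PermIso K H
  | ⟨e, he⟩ => ⟨e.symm, he.symm⟩

theorem trans : PermIso H K → PermIso K L → PermIso H L
  | ⟨e, he⟩, ⟨f, hf⟩ => ⟨e.trans f, fun h => (hf (e.permCongr h)).trans (he h)⟩

theorem map (e : X ≃ Y) (H : Subgroup (Equiv.Perm X)) :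
    PermIso H (H.map e.permCongrHom.toMonoidHom) :=
  ⟨e, carriesTo_map e H⟩

end PermIso

theorem subgroupConjClass_eq_iff {n : ℕ} {H K : Subgroup (Equiv.Perm (Fin n))} :
    subgroupConjClass H = subgroupConjClass K ↔ PermIso H K := by
  have smul_eq_iff (e : Equiv.Perm (Fin n)) : ConjAct.toConjAct e • H = K ↔ CarriesTo e H K := by
    have hsmul (h) : ConjAct.toConjAct e • h = e.permCongr h := by
      ext x
      simp [ConjAct.toConjAct_smul, Equiv.Perm.inv_def]
    rw [SetLike.ext_iff, e.permCongr.surjective.forall]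
    refine forall_congr' fun h => ?_
    rw [← hsmul, Subgroup.smul_mem_pointwise_smul_iff, hsmul]
    exact iff_comm
  rw [eq_comm]
  exact Quotient.eq.trans (ConjAct.toConjAct.surjective.exists.trans (exists_congr smul_eq_iff))

theorem classOn_eq_classOn_iff [Fintype X] [Fintype Y] {i : ℕ} (hX : Fintype.card X = i)
    (hY : Fintype.card Y = i) : classOn hX H = classOn hY K ↔ PermIso H K := by
  have hH := PermIso.map (Fintype.equivFinOfCardEq hX) H
  have hK := PermIso.map (Fintype.equivFinOfCardEq hY) K
  exact subgroupConjClass_eq_iff.trans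
    ⟨fun h => hH.trans (h.trans hK.symm), fun h => hH.symm.trans (h.trans hK)⟩

theorem isTruncation_permCongr_iff {e : X ≃ Y} {S : Set Y} {h g : Equiv.Perm X} :
    IsTruncation S (e.permCongr h) (e.permCongr g) ↔ IsTruncation (e ⁻¹' S) h g := by
  have heq : (∀ y ∈ S, e.permCongr g y = e.permCongr h y) ↔ ∀ x ∈ e ⁻¹' S, g x = h x := by
    simp [e.surjective.forall]
  have hfix : (∀ y ∉ S, e.permCongr g y = y) ↔ ∀ x ∉ e ⁻¹' S, g x = x := by
    simp [e.surjective.forall]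
  exact ⟨fun ⟨h₁, h₂⟩ => ⟨heq.1 h₁, hfix.1 h₂⟩, fun ⟨h₁, h₂⟩ => ⟨heq.2 h₁, hfix.2 h₂⟩⟩

theorem CarriesTo.splits_iff {e : X ≃ Y} (he : CarriesTo e H K) {S : Set Y} :
    Splits K S ↔ Splits H (e ⁻¹' S) := by
  simp only [Splits, e.permCongr.surjective.forall, e.permCongr.surjective.exists, he _,
    isTruncation_permCongr_iff]

theorem CarriesTo.isSplitAtom_iff {e : X ≃ Y} (he : CarriesTo e H K) {S : Set Y} :
    IsSplitAtom K S ↔ IsSplitAtom H (e ⁻¹' S) := by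
  simp only [IsSplitAtom, Minimal, e.injective.preimage_surjective.forall, he.splits_iff,
    e.surjective.nonempty_preimage, e.surjective.preimage_subset_preimage_iff]

theorem PermIso.isConnectedSubgroup [Fintype X] [DecidableEq X] [Fintype Y] [DecidableEq Y]
    (h : PermIso H K) (hH : IsConnectedSubgroup H) : IsConnectedSubgroup K := by
  obtain ⟨e, he⟩ := h
  rw [isConnectedSubgroup_iff] at hH ⊢
  exact he.isSplitAtom_iff.2 hH

end PermIso

section SigmaProduct

variable {ι κ : Type*} {F : ι → Type*} {G : κ → Type*} {K : ∀ j, Subgroup (Equiv.Perm (F j))}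
  {L : ∀ k, Subgroup (Equiv.Perm (G k))}

/-- The direct product of the permutation groups `K j`, acting on the disjoint union of the sets
on which they act. -/
def sigmaProduct (K : ∀ j, Subgroup (Equiv.Perm (F j))) : Subgroup (Equiv.Perm (Σ j, F j)) :=
  (Subgroup.pi Set.univ K).map (Equiv.Perm.sigmaCongrRightHom F)

theorem mem_sigmaProduct {σ : Equiv.Perm (Σ j, F j)} :
    σ ∈ sigmaProduct K ↔ ∀ j, ∃ τ ∈ K j, ∀ x, σ ⟨j, x⟩ = ⟨j, τ x⟩ := by
  constructor
  · rintro ⟨τ, hτ, rfl⟩ j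
    exact ⟨τ j, hτ j (Set.mem_univ j), fun _ => rfl⟩
  · intro hσ
    choose τ hτ hστ using hσ
    exact ⟨τ, fun j _ => hτ j, Equiv.ext fun x => (hστ x.1 x.2).symm⟩

theorem exists_mem_sigmaProduct_of_mem {j : ι} {τ : Equiv.Perm (F j)} (hτ : τ ∈ K j) :
    ∃ σ ∈ sigmaProduct K, (∀ x, σ ⟨j, x⟩ = ⟨j, τ x⟩) ∧ ∀ y, y.1 ≠ j → σ y = y := by
  classical
  have hτK : Pi.mulSingle j τ ∈ Subgroup.pi Set.univ K :=
    (Subgroup.mulSingle_mem_pi (H := K) j τ).2 fun _ => hτ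
  refine ⟨_, Subgroup.mem_map_of_mem _ hτK, fun x => by simp, ?_⟩
  rintro ⟨i, x⟩ (hij : i ≠ j)
  simp [hij]

theorem mem_iff_exists_mem_sigmaProduct {j : ι} {τ : Equiv.Perm (F j)} :
    τ ∈ K j ↔ ∃ σ ∈ sigmaProduct K, ∀ x, σ ⟨j, x⟩ = ⟨j, τ x⟩ := by
  constructor
  · intro hτ
    obtain ⟨σ, hσ, hστ, -⟩ := exists_mem_sigmaProduct_of_mem hτ
    exact ⟨σ, hσ, hστ⟩
  · rintro ⟨σ, hσ, hστ⟩
    obtain ⟨ρ, hρ, hσρ⟩ := mem_sigmaProduct.1 hσ j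
    obtain rfl : τ = ρ := Equiv.ext fun x => sigma_mk_injective ((hστ x).symm.trans (hσρ x))
    exact hρ

theorem splits_sigmaProduct (K : ∀ j, Subgroup (Equiv.Perm (F j))) (j : ι) :
    Splits (sigmaProduct K) (Sigma.fst ⁻¹' {j}) := by
  intro σ hσ
  obtain ⟨τ, hτ, hστ⟩ := mem_sigmaProduct.1 hσ j
  obtain ⟨ρ, hρ, hρτ, hfix⟩ := exists_mem_sigmaProduct_of_mem hτ
  refine ⟨ρ, hρ, ?_, hfix⟩
  rintro ⟨i, x⟩ rfl
  rw [hστ, hρτ]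

theorem PermIso.sigmaProduct (φ : ι ≃ κ) (hφ : ∀ j, PermIso (K j) (L (φ j))) :
    PermIso (sigmaProduct K) (sigmaProduct L) := by
  choose E hE using hφ
  refine ⟨Equiv.sigmaCongr φ E, fun σ => ?_⟩
  have happly (j : ι) (x : F j) : (Equiv.sigmaCongr φ E).permCongr σ ⟨φ j, E j x⟩ =
      Equiv.sigmaCongr φ E (σ ⟨j, x⟩) := by
    change (Equiv.sigmaCongr φ E).permCongr σ (Equiv.sigmaCongr φ E ⟨j, x⟩) = _
    simp
  rw [mem_sigmaProduct, mem_sigmaProduct, φ.surjective.forall]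
  refine forall_congr' fun j => ?_
  rw [(E j).permCongr.surjective.exists]
  refine exists_congr fun τ => and_congr (hE j τ) ?_
  rw [(E j).surjective.forall]
  refine forall_congr' fun x => ?_
  rw [happly, Equiv.permCongr_apply, Equiv.symm_apply_apply]
  exact (Equiv.sigmaCongr φ E).apply_eq_iff_eq (y := ⟨j, τ x⟩)

end SigmaProduct

section Decomposition

variable {X F : Type*} [DecidableEq X] {H : Subgroup (Equiv.Perm X)}

theorem Splits.permIso_restrict {K : Subgroup (Equiv.Perm F)} {Y : Finset X} {f : F → X}
    (hY : Splits H Y) (hf : Function.Injective f) (hfY : Set.range f = Y)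
    (hK : ∀ τ, τ ∈ K ↔ ∃ h ∈ H, ∀ x, h (f x) = f (τ x)) : PermIso K (restrict H Y) := by
  let e : F ≃ Y := (Equiv.ofInjective f hf).trans (Equiv.setCongr hfY)
  have he (x : F) : (e x : X) = f x := rfl
  refine ⟨e, fun τ => ?_⟩
  rw [hY.mem_restrict_iff, hK]
  simp only [e.surjective.forall, he, Equiv.permCongr_apply, Equiv.symm_apply_apply]

theorem permIso_sigmaProduct_restrict [Fintype X] {P : Finpartition (Finset.univ : Finset X)}
    (hP : ∀ Y ∈ P.parts, Splits H Y) :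
    PermIso (sigmaProduct fun Y : P.parts => restrict H Y.1) H := by
  let e : X ≃ Σ Y : P.parts, Y.1 :=
    (Equiv.subtypeUnivEquiv Finset.mem_univ).symm.trans P.equivSigmaParts
  have he (Y : P.parts) (y : Y.1) : e y = ⟨Y, y⟩ :=
    e.eq_symm_apply.1 rfl
  refine PermIso.symm ⟨e, fun h => ?_⟩
  have hmem : h ∈ H ↔ ∀ Y : P.parts, ∃ τ ∈ restrict H Y.1, ∀ y : Y.1, h y = τ y := by
    refine ⟨fun hh Y => exists_isTruncation_iff_exists_mem_restrict.1 (hP Y.1 Y.2 h hh),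
      fun hh => mem_of_forall_exists_isTruncation (P := P) fun Y hY => ?_⟩
    exact exists_isTruncation_iff_exists_mem_restrict.2 (hh ⟨Y, hY⟩)
  rw [hmem, mem_sigmaProduct]
  refine forall_congr' fun Y => exists_congr fun τ => and_congr_right fun _ =>
    forall_congr' fun y => ?_
  rw [← he, ← he, Equiv.permCongr_apply, Equiv.symm_apply_apply, e.apply_eq_iff_eq]

theorem exists_permIso_restrict_of_sigmaProduct [Fintype X] {ι : Type*} [DecidableEq ι]
    {F : ι → Type*} {K : ∀ j, Subgroup (Equiv.Perm (F j))} (h : PermIso (sigmaProduct K) H) :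
    ∃ f : X → ι, ∀ j, Splits H ({x | f x = j} : Finset X) ∧
      PermIso (K j) (restrict H {x | f x = j}) := by
  obtain ⟨e, he⟩ := h
  refine ⟨fun x => (e.symm x).1, fun j => ?_⟩
  have hcoe : (({x | (e.symm x).1 = j} : Finset X) : Set X) = e.symm ⁻¹' (Sigma.fst ⁻¹' {j}) :=
    Finset.coe_filter_univ _
  have hsplits := hcoe ▸ he.symm.splits_iff.1 (splits_sigmaProduct K j)
  refine ⟨hsplits, hsplits.permIso_restrict (f := fun x => e ⟨j, x⟩)
    (e.injective.comp sigma_mk_injective) ?_ fun τ => ?_⟩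
  · ext x
    rw [hcoe]
    constructor
    · rintro ⟨y, rfl⟩
      simp
    · rintro rfl
      exact ⟨_, e.apply_symm_apply x⟩
  · rw [mem_iff_exists_mem_sigmaProduct, e.permCongr.surjective.exists]
    simp [he _]

end Decomposition

section FactorTypes

variable {X Y : Type*} [Fintype X] [DecidableEq X] [Fintype Y] [DecidableEq Y]
  {H : Subgroup (Equiv.Perm X)} {K : Subgroup (Equiv.Perm Y)}

theorem classOn_eq_subgroupConjClass {n : ℕ} (H : Subgroup (Equiv.Perm (Fin n))) :
    classOn (Fintype.card_fin n) H = subgroupConjClass H :=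
  subgroupConjClass_eq_iff.2 (PermIso.map _ H).symm

theorem exists_isConnectedSubgroup_classOn_eq {i : ℕ} (h : Fintype.card X = i)
    (hH : IsConnectedSubgroup H) :
    ∃ K, IsConnectedSubgroup K ∧ subgroupConjClass K = classOn h H :=
  ⟨_, (PermIso.map _ H).isConnectedSubgroup hH, rfl⟩

/-- The type of a connected permutation group: its degree together with its class of subgroups of
the symmetric group of that degree. -/
noncomputable def connectedType (hH : IsConnectedSubgroup H) : Σ i, ConnectedClass i :=
  ⟨Fintype.card X, classOn rfl H, exists_isConnectedSubgroup_classOn_eq rfl hH⟩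

theorem connectedType_eq_mk {i : ℕ} (hH : IsConnectedSubgroup H) (h : Fintype.card X = i) :
    connectedType hH = ⟨i, classOn h H, exists_isConnectedSubgroup_classOn_eq h hH⟩ := by
  subst h
  rfl

theorem connectedType_eq_iff {hH : IsConnectedSubgroup H} {hK : IsConnectedSubgroup K} :
    connectedType hH = connectedType hK ↔ PermIso H K := by
  constructor
  · intro h
    have hcard : Fintype.card X = Fintype.card Y := congrArg Sigma.fst h
    rw [connectedType_eq_mk hH hcard, connectedType_eq_mk hK rfl, Sigma.mk.injEq, heq_eq_eq,
      Subtype.mk.injEq] at h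
    exact (classOn_eq_classOn_iff hcard rfl).1 h.2
  · rintro ⟨e, he⟩
    rw [connectedType_eq_mk hH (Fintype.card_congr e), connectedType]
    congr 2
    exact (classOn_eq_classOn_iff (Fintype.card_congr e) rfl).2 ⟨e, he⟩

theorem exists_connectedType_eq (t : Σ i, ConnectedClass i) :
    ∃ (H : Subgroup (Equiv.Perm (Fin t.1))) (hH : IsConnectedSubgroup H),
      connectedType hH = t := by
  obtain ⟨i, -, H, hH, rfl⟩ := t
  refine ⟨H, hH, ?_⟩
  rw [connectedType_eq_mk hH (Fintype.card_fin i)]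
  congr 2
  exact classOn_eq_subgroupConjClass H

/-- The multiset of types of the connected factors of `H`. -/
noncomputable def factorTypes (H : Subgroup (Equiv.Perm X)) : Multiset (Σ i, ConnectedClass i) :=
  Finset.univ.val.map fun Y : (finest H).parts => connectedType (isConnectedSubgroup_restrict Y.2)

theorem map_fst_factorTypes (H : Subgroup (Equiv.Perm X)) :
    (factorTypes H).map Sigma.fst = (finest H).parts.val.map Finset.card := by
  rw [factorTypes, Multiset.map_map, ← Multiset.attach_map_val' (finest H).parts.val]
  exact Multiset.map_congr rfl fun Y _ => Fintype.card_coe Y.1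

theorem sum_map_fst_factorTypes (H : Subgroup (Equiv.Perm X)) :
    ((factorTypes H).map Sigma.fst).sum = Fintype.card X := by
  rw [map_fst_factorTypes]
  exact (finest H).sum_card_parts

theorem factorTypes_eq_of_permIso_sigmaProduct {ι : Type*} [Fintype ι] {F : ι → Type*}
    [∀ j, Fintype (F j)] [∀ j, DecidableEq (F j)] {K : ∀ j, Subgroup (Equiv.Perm (F j))}
    (hK : ∀ j, IsConnectedSubgroup (K j)) (h : PermIso (sigmaProduct K) H) :
    factorTypes H = Finset.univ.val.map fun j => connectedType (hK j) := by
  classical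
  -- The blocks of `X` carrying the connected groups `K j` are split atoms, and they cover `X`.
  obtain ⟨f, hf⟩ := exists_permIso_restrict_of_sigmaProduct h
  let B (j : ι) : Finset X := {x | f x = j}
  have mem_B {j : ι} {x : X} : x ∈ B j ↔ f x = j := by simp [B]
  have hB (j : ι) : B j ∈ (finest H).parts :=
    (mem_finest_parts_iff_isConnectedSubgroup (hf j).1).2 ((hf j).2.isConnectedSubgroup (hK j))
  have hbij : Function.Bijective fun j => (⟨B j, hB j⟩ : (finest H).parts) := by
    refine ⟨fun i j hij => ?_, fun Y => ?_⟩
    · obtain ⟨x, hx⟩ := (finest H).nonempty_of_mem_parts (hB i)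
      exact (mem_B.1 hx).symm.trans (mem_B.1 (Subtype.mk.inj hij ▸ hx))
    · obtain ⟨x, hx⟩ := (finest H).nonempty_of_mem_parts Y.2
      exact ⟨f x, Subtype.ext ((finest H).eq_of_mem_parts (hB _) Y.2 (mem_B.2 rfl) hx)⟩
  have htype (j : ι) :
      connectedType (hK j) = connectedType (isConnectedSubgroup_restrict (hB j)) :=
    connectedType_eq_iff.2 (hf j).2
  simp only [htype]
  rw [factorTypes, ← Multiset.map_univ_val_equiv (Equiv.ofBijective _ hbij), Multiset.map_map]
  rfl

theorem exists_equiv_of_map_univ_eq {ι κ α : Type*} [Fintype ι] [Fintype κ] {f : ι → α}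
    {g : κ → α} (h : Finset.univ.val.map f = Finset.univ.val.map g) :
    ∃ e : ι ≃ κ, ∀ i, g (e i) = f i := by
  classical
  have hfiber (a : α) : Nonempty ({i // f i = a} ≃ {k // g k = a}) := by
    have hcount := congrArg (Multiset.count a) h
    rw [Multiset.count_map, Multiset.count_map] at hcount
    rw [← Fintype.card_eq, Fintype.card_subtype, Fintype.card_subtype]
    simpa [Finset.card, eq_comm] using hcount
  have E (a : α) := (hfiber a).some
  exact ⟨(Equiv.sigmaFiberEquiv f).symm.trans ((Equiv.sigmaCongrRight E).trans
    (Equiv.sigmaFiberEquiv g)), fun i => (E (f i) ⟨i, rfl⟩).2⟩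

theorem permIso_sigmaProduct_finest (H : Subgroup (Equiv.Perm X)) :
    PermIso (sigmaProduct fun Y : (finest H).parts => restrict H Y.1) H :=
  permIso_sigmaProduct_restrict fun _ hY => (mem_finest_parts_iff.1 hY).splits

theorem factorTypes_eq_iff : factorTypes H = factorTypes K ↔ PermIso H K := by
  constructor
  · intro h
    obtain ⟨φ, hφ⟩ := exists_equiv_of_map_univ_eq h
    exact (permIso_sigmaProduct_finest H).symm.trans
      ((PermIso.sigmaProduct φ fun Y => connectedType_eq_iff.1 (hφ Y).symm).trans
        (permIso_sigmaProduct_finest K))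
  · intro h
    exact (factorTypes_eq_of_permIso_sigmaProduct _
      ((permIso_sigmaProduct_finest H).trans h)).symm

theorem exists_factorTypes_eq {n : ℕ} {s : Multiset (Σ i, ConnectedClass i)}
    (hs : (s.map Sigma.fst).sum = n) :
    ∃ H : Subgroup (Equiv.Perm (Fin n)), factorTypes H = s := by
  classical
  choose K hK hKt using exists_connectedType_eq
  let L (t : s) := K t.1
  have htypes {Y : Type} [Fintype Y] [DecidableEq Y] {H : Subgroup (Equiv.Perm Y)}
      (h : PermIso (sigmaProduct L) H) : factorTypes H = s := by
    rw [factorTypes_eq_of_permIso_sigmaProduct (fun t => hK t.1) h]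
    simp only [hKt, Multiset.map_univ_coe]
  have hcard : Fintype.card (Σ t : s, Fin t.1.1) = n := by
    rw [← sum_map_fst_factorTypes (sigmaProduct L), htypes (.refl _), hs]
  exact ⟨_, htypes (.map (Fintype.equivFinOfCardEq hcard) _)⟩

end FactorTypes

section Fiber

variable {κ : Type*} [DecidableEq κ] {α : κ → Type*}

/-- The elements of a multiset of a sigma type that lie in the `i`-th summand. -/
def fiber (s : Multiset (Σ i, α i)) (i : κ) : Multiset (α i) :=
  s.filterMap fun t => if h : t.1 = i then some (h ▸ t.2) else none

theorem map_mk_fiber (s : Multiset (Σ i, α i)) (i : κ) :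
    (fiber s i).map (Sigma.mk i) = s.filter fun t => t.1 = i := by
  induction s using Multiset.induction_on with
  | empty => rfl
  | cons t s ih =>
    rw [fiber] at ih ⊢
    obtain ⟨j, a⟩ := t
    by_cases h : j = i
    · subst h
      rw [Multiset.filterMap_cons_some _ _ _ (dif_pos rfl), Multiset.map_cons, ih,
        Multiset.filter_cons_of_pos (p := fun t : Σ k, α k => t.1 = j) _ rfl]
    · rw [Multiset.filterMap_cons_none _ _ (dif_neg h), ih,
        Multiset.filter_cons_of_neg (p := fun t : Σ k, α k => t.1 = i) _ h]

theorem card_fiber (s : Multiset (Σ i, α i)) (i : κ) :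
    (fiber s i).card = (s.map Sigma.fst).count i := by
  rw [← Multiset.card_map (Sigma.mk i), map_mk_fiber, Multiset.count_map]
  simp only [eq_comm]

theorem eq_of_fiber_eq {s t : Multiset (Σ i, α i)} (h : ∀ i, fiber s i = fiber t i) : s = t := by
  classical
  ext a
  have count_eq (u : Multiset (Σ i, α i)) :
      u.count a = ((fiber u a.1).map (Sigma.mk a.1)).count a := by
    rw [map_mk_fiber, Multiset.count_filter_of_pos (p := fun t : Σ i, α i => t.1 = a.1) rfl]
  rw [count_eq s, count_eq t, h]

theorem fiber_sum_map_mk {I : Finset κ} (c : ∀ i : I, Multiset (α i)) (i : I) :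
    fiber (∑ j : I, (c j).map (Sigma.mk (j : κ))) i = c i := by
  let filterHom : Multiset (Σ k, α k) →+ Multiset (Σ k, α k) :=
    { toFun := Multiset.filter fun t => t.1 = (i : κ)
      map_zero' := Multiset.filter_zero _
      map_add' := Multiset.filter_add _ }
  refine Multiset.map_injective sigma_mk_injective ?_
  rw [map_mk_fiber]
  change filterHom _ = _
  rw [map_sum, Finset.sum_eq_single i _ (by simp)]
  · refine Multiset.filter_eq_self.2 fun t ht => ?_
    obtain ⟨a, -, rfl⟩ := Multiset.mem_map.1 ht
    rfl
  · refine fun j _ hj => Multiset.filter_eq_nil.2 fun t ht => ?_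
    obtain ⟨a, -, rfl⟩ := Multiset.mem_map.1 ht
    exact fun h => hj (Subtype.ext h)

theorem fiber_map_univ {ι : Type*} [Fintype ι] (f : ι → Σ i, α i) (i : κ) :
    fiber (Finset.univ.val.map f) i =
      (Finset.univ : Finset {x // (f x).1 = i}).val.map fun x => x.2 ▸ (f x).2 := by
  have huniv : (Finset.univ : Finset {x // (f x).1 = i}).val.map Subtype.val =
      Finset.univ.val.filter fun x => (f x).1 = i := by
    rw [← Finset.subtype_univ]
    exact congrArg Finset.val (Finset.subtype_map (s := Finset.univ) fun x => (f x).1 = i)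
  refine Multiset.map_injective sigma_mk_injective ?_
  rw [map_mk_fiber, Multiset.filter_map]
  change Multiset.map f (Multiset.filter (fun x => (f x).1 = i) Finset.univ.val) = _
  rw [← huniv, Multiset.map_map, Multiset.map_map]
  refine Multiset.map_congr rfl ?_
  rintro ⟨x, rfl⟩ _
  rfl

end Fiber

section PartitionPair

variable {n : ℕ}

theorem mem_Icc_of_mem_parts (p : n.Partition) {i : ℕ} (hi : i ∈ p.parts) : i ∈ Finset.Icc 1 n :=
  Finset.mem_Icc.2 ⟨p.parts_pos hi, (Multiset.le_sum_of_mem hi).trans_eq p.parts_sum⟩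

theorem pos_of_connectedClass {i : ℕ} (c : ConnectedClass i) : 0 < i := by
  obtain ⟨H, hH, -⟩ := c.2
  exact Fin.pos_iff_nonempty.2
    (Set.nonempty_iff_univ_nonempty.2 (isConnectedSubgroup_iff.1 hH).nonempty)

theorem partitionPair_ext {A B : PartitionPair n} (hshape : A.shape.parts = B.shape.parts)
    (hclasses : ∀ i, (A.classes i).1 = (B.classes i).1) : A = B := by
  obtain ⟨p, C⟩ := A
  obtain ⟨q, D⟩ := B
  obtain rfl : p = q := Nat.Partition.ext hshape
  obtain rfl : C = D := funext fun i => Subtype.ext (hclasses i)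
  rfl

/-- The pair `(λ, (C_1, …, C_n))` of a multiset of connected classes of total degree `n`: the
parts of `λ` are the degrees, and `C_i` collects the classes of degree `i`. -/
def toPartitionPair (s : {s : Multiset (Σ i, ConnectedClass i) // (s.map Sigma.fst).sum = n}) :
    PartitionPair n where
  shape :=
    { parts := s.1.map Sigma.fst
      parts_pos := fun hi => by
        obtain ⟨t, -, rfl⟩ := Multiset.mem_map.1 hi
        exact pos_of_connectedClass t.2
      parts_sum := s.2 }
  classes i := ⟨fiber s.1 i, card_fiber s.1 i⟩

theorem fiber_eq_zero_of_notMem_Icc {s : Multiset (Σ i, ConnectedClass i)}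
    (hs : (s.map Sigma.fst).sum = n) {i : ℕ} (hi : i ∉ Finset.Icc 1 n) : fiber s i = 0 := by
  rw [← Multiset.card_eq_zero, card_fiber, Multiset.count_eq_zero]
  exact mt (mem_Icc_of_mem_parts (toPartitionPair ⟨s, hs⟩).shape) hi

theorem toPartitionPair_injective : Function.Injective (toPartitionPair (n := n)) := by
  rintro ⟨s, hs⟩ ⟨t, ht⟩ h
  refine Subtype.ext (eq_of_fiber_eq fun i => ?_)
  by_cases hi : i ∈ Finset.Icc 1 n
  · exact congrArg (fun A => (A.classes ⟨i, hi⟩).1) h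
  · rw [fiber_eq_zero_of_notMem_Icc hs hi, fiber_eq_zero_of_notMem_Icc ht hi]

theorem map_fst_sum_classes (A : PartitionPair n) :
    (∑ i : Finset.Icc 1 n, (A.classes i).1.map (Sigma.mk (i : ℕ))).map Sigma.fst =
      A.shape.parts := by
  ext i
  rw [← card_fiber]
  by_cases hi : i ∈ Finset.Icc 1 n
  · rw [fiber_sum_map_mk (fun i => (A.classes i).1) ⟨i, hi⟩]
    exact (A.classes ⟨i, hi⟩).2
  · rw [Multiset.count_eq_zero_of_notMem (mt (mem_Icc_of_mem_parts _) hi), card_fiber,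
      Multiset.count_eq_zero]
    intro h
    obtain ⟨t, ht, rfl⟩ := Multiset.mem_map.1 h
    obtain ⟨j, -, hj⟩ := Multiset.mem_sum.1 ht
    obtain ⟨c, -, rfl⟩ := Multiset.mem_map.1 hj
    exact hi j.2

theorem toPartitionPair_surjective : Function.Surjective (toPartitionPair (n := n)) := fun A =>
  ⟨⟨∑ i : Finset.Icc 1 n, (A.classes i).1.map (Sigma.mk (i : ℕ)), by
    rw [map_fst_sum_classes, A.shape.parts_sum]⟩,
    partitionPair_ext (map_fst_sum_classes A) (fiber_sum_map_mk fun i => (A.classes i).1)⟩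

end PartitionPair

section Classification

variable {n : ℕ}

/-- The multiset of types of the connected factors of any member of a conjugacy class of subgroups
of `S_n`. -/
noncomputable def classFactorTypes :
    SubgroupConjClass n → {s : Multiset (Σ i, ConnectedClass i) // (s.map Sigma.fst).sum = n} :=
  Quotient.lift
    (fun H => ⟨factorTypes H, (sum_map_fst_factorTypes H).trans (Fintype.card_fin n)⟩)
    fun _ _ hHK => Subtype.ext <|
      factorTypes_eq_iff.2 (subgroupConjClass_eq_iff.1 (Quotient.sound hHK))

theorem classFactorTypes_bijective : Function.Bijective (classFactorTypes (n := n)) := by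
  constructor
  · rintro ⟨H⟩ ⟨K⟩ h
    exact subgroupConjClass_eq_iff.2 (factorTypes_eq_iff.1 (Subtype.mk.inj h))
  · rintro ⟨s, hs⟩
    obtain ⟨H, hH⟩ := exists_factorTypes_eq hs
    exact ⟨subgroupConjClass H, Subtype.ext hH⟩

/-- The bijection sending the class of a subgroup of `S_n` to the pair
`(λ, (C_1, …, C_n))` formed by the types of its connected factors. -/
noncomputable def classEquivPartitionPair (n : ℕ) : SubgroupConjClass n ≃ PartitionPair n :=
  .ofBijective (toPartitionPair ∘ classFactorTypes)
    (.comp ⟨toPartitionPair_injective, toPartitionPair_surjective⟩ classFactorTypes_bijective)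

theorem shape_classEquivPartitionPair (H : Subgroup (Equiv.Perm (Fin n))) :
    (classEquivPartitionPair n (subgroupConjClass H)).shape.parts =
      (finest H).parts.val.map Finset.card :=
  map_fst_factorTypes H

theorem map_val_fiber_factorTypes {X : Type*} [Fintype X] [DecidableEq X]
    (H : Subgroup (Equiv.Perm X)) (i : ℕ) :
    (fiber (factorTypes H) i).map Subtype.val =
      factorClasses (finest H) (fun Y => restrict H Y.1) i := by
  rw [factorTypes, fiber_map_univ, Multiset.map_map]
  refine Multiset.map_congr rfl ?_
  rintro ⟨Y, rfl⟩ _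
  rfl

theorem classes_classEquivPartitionPair (H : Subgroup (Equiv.Perm (Fin n)))
    (i : Finset.Icc 1 n) :
    ((classEquivPartitionPair n (subgroupConjClass H)).classes i).1.map Subtype.val =
      factorClasses (finest H) (fun Y => restrict H Y.1) i :=
  map_val_fiber_factorTypes H i

end Classification

section EulerTransform

open PowerSeries

variable {R : Type*} [CommRing R]

theorem mk_one_pow_eq_mk_multichoose (d : ℕ) :
    (mk 1 : R⟦X⟧) ^ d = mk fun j => (Nat.multichoose d j : R) := by
  cases d with
  | zero =>
    ext j
    cases j <;> simp [coeff_one]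
  | succ d =>
    rw [mk_one_pow_eq_mk_choose_add]
    ext j
    rw [coeff_mk, coeff_mk, Nat.multichoose_eq, Nat.succ_add_sub_one, Nat.choose_symm_add]

theorem invOfUnit_one_sub_X_pow {k : ℕ} (hk : k ≠ 0) :
    invOfUnit (1 - X ^ k : R⟦X⟧) 1 = expand k hk (mk 1) := by
  have hinv : (1 - X ^ k : R⟦X⟧) * invOfUnit (1 - X ^ k) 1 = 1 :=
    mul_invOfUnit _ _ (by simp [hk])
  have hgeom : expand k hk (mk 1) * (1 - X ^ k : R⟦X⟧) = 1 := by
    simpa using congrArg (expand k hk) (mk_one_mul_one_sub_eq_one R)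
  exact (left_inv_eq_right_inv hgeom hinv).symm

open scoped PowerSeries.WithPiTopology in
theorem expand_mk_eq_tsum [TopologicalSpace R] [T2Space R] {k : ℕ} (hk : k ≠ 0) (a : ℕ → R) :
    expand k hk (mk a) = C (a 0) + ∑' j, a (j + 1) • X ^ (k * (j + 1)) := by
  have hsum := Nat.Partition.summable_genFun_term' (fun _ j => a j) hk
  ext m
  rw [map_add, hsum.map_tsum _ (WithPiTopology.continuous_coeff _ _), coeff_expand, coeff_mk]
  simp only [map_smul, coeff_X_pow, coeff_C, smul_eq_mul, mul_ite, mul_one, mul_zero]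
  by_cases hd : k ∣ m
  · obtain ⟨q, rfl⟩ := hd
    rw [if_pos (dvd_mul_right k q), Nat.mul_div_cancel_left _ (Nat.pos_of_ne_zero hk)]
    cases q with
    | zero => simp [hk]
    | succ q =>
      rw [tsum_eq_single q fun j hj => if_neg (by simpa [hk] using hj.symm)]
      simp [hk]
  · have hm : m ≠ 0 := fun h => hd (h ▸ dvd_zero k)
    have hne (j : ℕ) : m ≠ k * (j + 1) := fun h => hd ⟨_, h⟩
    simp [hd, hm, hne]

open scoped PowerSeries.WithPiTopology in
theorem invOfUnit_one_sub_X_pow_pow [TopologicalSpace R] [T2Space R] {k : ℕ} (hk : k ≠ 0)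
    (d : ℕ) : (invOfUnit (1 - X ^ k : R⟦X⟧) 1) ^ d =
      1 + ∑' j, (Nat.multichoose d (j + 1) : R) • X ^ (k * (j + 1)) := by
  rw [invOfUnit_one_sub_X_pow hk, ← map_pow, mk_one_pow_eq_mk_multichoose, expand_mk_eq_tsum]
  simp only [Nat.multichoose_zero_right, Nat.cast_one, map_one]

open scoped PowerSeries.WithPiTopology in
theorem isEulerTransform_of_eq_sum_partition {m c : ℕ → ℕ}
    (hm : ∀ n, m n = ∑ p : n.Partition, p.parts.toFinsupp.prod
      fun i j => (c i).multichoose j) : IsEulerTransform m c := by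
  have hprod := Nat.Partition.hasProd_genFun (R := ℤ) fun i j => ((c i).multichoose j : ℤ)
  have hgenFun : Nat.Partition.genFun (fun i j => ((c i).multichoose j : ℤ)) =
      1 + PowerSeries.mk fun n => if n = 0 then 0 else (m n : ℤ) := by
    ext n
    have hcoeff : coeff n (Nat.Partition.genFun fun i j => ((c i).multichoose j : ℤ)) = m n := by
      rw [Nat.Partition.coeff_genFun, hm]
      push_cast [Finsupp.prod]
      rfl
    rcases eq_or_ne n 0 with rfl | hn
    · simp
    · simp [hcoeff, coeff_one, hn]
  rw [hgenFun, funext fun i =>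
    (invOfUnit_one_sub_X_pow_pow (R := ℤ) (Nat.succ_ne_zero i) _).symm] at hprod
  rw [IsEulerTransform, ← Equiv.pnatEquivNat.symm.hasProd_iff]
  exact hprod

theorem card_partitionPair (n : ℕ) : Nat.card (PartitionPair n) =
    ∑ p : n.Partition, p.parts.toFinsupp.prod
      fun i j => (Nat.card (ConnectedClass i)).multichoose j := by
  let equivSigma : PartitionPair n ≃
      Σ p : n.Partition, ∀ i : Finset.Icc 1 n, Sym (ConnectedClass i) (p.parts.count (i : ℕ)) :=
    ⟨fun A => ⟨A.shape, A.classes⟩, fun B => ⟨B.1, B.2⟩, fun _ => rfl, fun _ => rfl⟩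
  rw [Nat.card_congr equivSigma, Nat.card_sigma]
  refine Finset.sum_congr rfl fun p _ => ?_
  have hsupp : p.parts.toFinsupp.support ⊆ Finset.Icc 1 n := fun i hi =>
    mem_Icc_of_mem_parts p (by simpa using hi)
  rw [Nat.card_pi, Finsupp.prod_of_support_subset _ hsupp _
    fun _ _ => Nat.multichoose_zero_right _]
  simp only [Sym.natCard_sym_eq_multichoose, Multiset.toFinsupp_apply]
  exact Finset.prod_coe_sort (Finset.Icc 1 n)
    fun i => (Nat.card (ConnectedClass i)).multichoose (p.parts.count i)

end EulerTransform

end PermGroup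

theorem mainTheorem2 :
    (∀ n : ℕ, ∃ Φ : SubgroupConjClass n ≃ PartitionPair n,
      ∀ H : Subgroup (Equiv.Perm (Fin n)),
        ∃ (P : Finpartition (Finset.univ : Finset (Fin n)))
          (K : ∀ Y : P.parts, Subgroup (Equiv.Perm Y.1)),
          IsFinestPartition H P ∧ IsBlockProduct H P K ∧
          (∀ Y, IsConnectedSubgroup (K Y)) ∧
          (Φ (subgroupConjClass H)).shape.parts = P.parts.val.map Finset.card ∧
          ∀ i : Finset.Icc 1 n,
            ((Φ (subgroupConjClass H)).classes i).1.map Subtype.val = factorClasses P K i) ∧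
    IsEulerTransform (fun n => Nat.card (SubgroupConjClass n))
      (fun k => Nat.card (ConnectedClass k)) := by
  refine ⟨fun n => ⟨PermGroup.classEquivPartitionPair n, fun H =>
    ⟨PermGroup.finest H, fun Y => PermGroup.restrict H Y.1, PermGroup.isFinestPartition_finest H,
      PermGroup.isBlockProduct_finest H, fun Y => PermGroup.isConnectedSubgroup_restrict Y.2,
      PermGroup.shape_classEquivPartitionPair H, PermGroup.classes_classEquivPartitionPair H⟩⟩,
    PermGroup.isEulerTransform_of_eq_sum_partition fun n => ?_⟩
  rw [Nat.card_congr (PermGroup.classEquivPartitionPair n), PermGroup.card_partitionPair]
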